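/- Let $(E,e)$ be an order unit space (a real partially ordered vector space with an Archimedean order unit $e$) that is complete and separable in its order unit norm $\|x\|=\inf\{r>0 : -re\le x\le re\}$. Let $S(E)$ be its state space, i.e. the set of positive linear functionals $\sigma\colon E\to\mathbb{R}$ with $\sigma(e)=1$, with the weak-* topology, and let $\partial_eS(E)$ be its set of extreme points. For $x\in E$ write $\widehat{x}(\sigma)=\sigma(x)$. Let $L\colon E\to[0,\infty]$ be a Lip-norm, i.e. a seminorm such that $L(x)=0$ if and only if $x\in\mathbb{R}e$, and such that the metric $$\rho_L(\sigma,\tau)=\sup\{|\sigma(x)-\tau(x)| : x\in E,\ L(x)\le 1\}$$ induces the weak-* topology on $S(E)$. Assume that $L$ is lower semicontinuous and densely finite (i.e. $\{x : L(x)<\infty\}$ is norm dense in $E$). For a real function $f$ on a set of states, let $L_{\rho_L}(f)=\sup_{\sigma\neq\tau}|f(\sigma)-f(\tau)|/\rho_L(\sigma,\tau)$ be its Lipschitz seminorm. A Choquet simplex is a compact convex set whose associated cone is a lattice; it is a Bauer simplex if its set of extreme points is compact. The pair $(E,L)$ as above is a quantum metric Bauer simplex if (a) $E$ has the Riesz interpolation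 property: whenever $x_1,x_2,y_1,y_2\in E$ satisfy $x_i\le y_j$ for all $i,j\in\{1,2\}$, there is $z\in E$ with $x_i\le z\le y_j$ for all $i,j$; (b) $S(E)$ is a Bauer simplex; and (c) for all $\sigma,\tau\in S(E)$, $$\rho_L(\sigma,\tau)=\sup\left\{\left|\int f\,d\mu_\sigma-\int f\,d\mu_\tau\right| : f\colon\partial_eS(E)\to\mathbb{R},\ |f(\omega)-f(\omega')|\le\rho_L(\omega,\omega')\text{ for all }\omega,\omega'\right\},$$ where $\mu_\sigma$ is the unique Borel probability measure on $\partial_eS(E)$ such that $g(\sigma)=\int g\,d\mu_\sigma$ for every continuous affine $g\colon S(E)\to\mathbb{R}$. Then $(E,L)$ is a quantum metric Bauer simplex if and only if 1. $E$ is a vector lattice, and 2. every Lipschitz function $f\colon(\partial_eS(E),\rho_L)\to\mathbb{R}$ admits a unique continuous affine extension $g\colon S(E)\to\mathbb{R}$, and this extension satisfies $\sup_{S(E)}|g|\le\sup_{\partial_eS(E)}|f|$ and $L_{\rho_L}(g)\le L_{\rho_L}(f)$. In this case, $L(x)=L_{\rho_L}\left(\widehat{x}|_{\partial_eS(E)}\right)$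 for every $x\in E$. -/

import Mathlib

open scoped ENNReal

namespace QuantumMetric

noncomputable section

/-! ### Compact convex sets and simplices -/

section Convex

variable {V : Type*} [AddCommGroup V] [Module ℝ V] [TopologicalSpace V]

/-- The inclusion of the extreme boundary of `K` into `K`. -/
def boundaryIncl {K : Set V} (x : K.extremePoints ℝ) : K :=
  ⟨x.1, extremePoints_subset x.2⟩

/-- Membership of `f : K → ℝ` in `Aff(K)`: continuous, and preserving convex combinations. -/
structure IsContAffine {K : Set V} (f : K → ℝ) : Prop where
  continuous : Continuous f
  affine : ∀ (x y z : K) (a b : ℝ), 0 ≤ a → 0 ≤ b → a + b = 1 →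
    (z : V) = a • (x : V) + b • (y : V) → f z = a * f x + b * f y

/-- The cone associated with a convex set `K`, i.e. the cone generated by the copy `K × {1}` of `K`
at height one. -/
def assocCone (K : Set V) : Set (V × ℝ) :=
  {p | ∃ t : ℝ, 0 ≤ t ∧ ∃ x ∈ K, p = (t • x, t)}

/-- The set `C` is a lattice in the order `p ≤ q ↔ q - p ∈ C`: any two elements have a least upper
bound and a greatest lower bound in `C`. -/
def IsLatticeCone {W : Type*} [AddCommGroup W] (C : Set W) : Prop :=
  ∀ p ∈ C, ∀ q ∈ C,
    (∃ s ∈ C, s - p ∈ C ∧ s - q ∈ C ∧ ∀ u ∈ C, u - p ∈ C → u - q ∈ C → u - s ∈ C) ∧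
    (∃ s ∈ C, p - s ∈ C ∧ q - s ∈ C ∧ ∀ u ∈ C, p - u ∈ C → q - u ∈ C → s - u ∈ C)

/-- A Choquet simplex: a compact convex set whose associated cone is a lattice. -/
structure IsChoquetSimplex (K : Set V) : Prop where
  isCompact : IsCompact K
  convex : Convex ℝ K
  lattice : IsLatticeCone (assocCone K)

/-- A Bauer simplex: a Choquet simplex with compact extreme boundary. -/
structure IsBauerSimplex (K : Set V) : Prop extends IsChoquetSimplex K where
  isCompact_boundary : IsCompact (K.extremePoints ℝ)

/-- The extreme boundary carries its Borel σ-algebra. -/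
instance boundaryMeasurableSpace (K : Set V) : MeasurableSpace (K.extremePoints ℝ) :=
  borel (K.extremePoints ℝ)

instance boundaryBorelSpace (K : Set V) : BorelSpace (K.extremePoints ℝ) := ⟨rfl⟩

/-- `μ` represents the point `x` of `K`: `f(x) = ∫ f dμ` for every `f ∈ Aff(K)`. -/
def Represents {K : Set V} (μ : MeasureTheory.ProbabilityMeasure (K.extremePoints ℝ))
    (x : K) : Prop :=
  ∀ f : K → ℝ, IsContAffine f →
    f x = ∫ y, f (boundaryIncl y) ∂(μ : MeasureTheory.Measure (K.extremePoints ℝ))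

/-- `μ` is `μ_x`, the unique Borel probability measure on the extreme boundary representing `x`. -/
def IsRepresentingMeasure {K : Set V}
    (μ : MeasureTheory.ProbabilityMeasure (K.extremePoints ℝ)) (x : K) : Prop :=
  Represents μ x ∧
    ∀ ν : MeasureTheory.ProbabilityMeasure (K.extremePoints ℝ), Represents ν x → ν = μ

end Convex

/-! ### Lipschitz seminorms and the Wasserstein metric, with values in `[0, ∞]` -/

section Metric

variable {X : Type*}

/-- The uniform norm `sup |f|`. -/
def uniformNorm (f : X → ℝ) : ℝ≥0∞ := ⨆ x, ‖f x‖ₑ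

/-- The Lipschitz seminorm `sup {|f(x) - f(y)| / d(x, y) | x ≠ y}`. -/
def lipSeminorm (d : X → X → ℝ≥0∞) (f : X → ℝ) : ℝ≥0∞ :=
  ⨆ (x : X) (y : X) (_ : x ≠ y), ‖f x - f y‖ₑ / d x y

/-- The Wasserstein distance
`sup {|∫ f dμ - ∫ f dν| | f : X → ℝ, |f(x) - f(y)| ≤ d(x, y) for all x, y}`. -/
def wasserstein [MeasurableSpace X] (d : X → X → ℝ≥0∞)
    (μ ν : MeasureTheory.ProbabilityMeasure X) : ℝ≥0∞ :=
  ⨆ (f : X → ℝ) (_ : ∀ x y, ‖f x - f y‖ₑ ≤ d x y),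
    ‖(∫ x, f x ∂(μ : MeasureTheory.Measure X)) - ∫ x, f x ∂(ν : MeasureTheory.Measure X)‖ₑ

end Metric

/-! ### Order unit spaces and compact quantum metric spaces -/

/-- Every two elements have a least upper bound and a greatest lower bound. -/
def IsVectorLattice (E : Type*) [PartialOrder E] : Prop :=
  ∀ x y : E, (∃ z, IsLUB {x, y} z) ∧ ∃ z, IsGLB {x, y} z

/-- The Riesz interpolation property. -/
def RieszInterpolation (E : Type*) [PartialOrder E] : Prop :=
  ∀ x₁ x₂ y₁ y₂ : E, x₁ ≤ y₁ → x₁ ≤ y₂ → x₂ ≤ y₁ → x₂ ≤ y₂ →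
    ∃ z, x₁ ≤ z ∧ x₂ ≤ z ∧ z ≤ y₁ ∧ z ≤ y₂

section OrderUnit

variable {E : Type*} [NormedAddCommGroup E] [NormedSpace ℝ E] [PartialOrder E]

/-- The ordered vector space `E` with the unit `e` is an order unit space, and the norm of `E` is
the associated order unit norm. -/
structure IsOrderUnitSpace (e : E) : Prop where
  order_unit : ∀ x : E, ∃ r : ℝ, 0 ≤ r ∧ x ≤ r • e
  archimedean : ∀ x : E, (∀ r : ℝ, 0 < r → x ≤ r • e) → x ≤ 0
  norm_eq : ∀ x : E, ‖x‖ = sInf {r : ℝ | 0 < r ∧ -(r • e) ≤ x ∧ x ≤ r • e}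

/-- The state space `S(E)`: the positive unital linear functionals, with the weak-* topology.
Requiring continuity is no restriction, see `exists_mem_stateSpace`. -/
def stateSpace (e : E) : Set (WeakDual ℝ E) :=
  {φ | (∀ x : E, 0 ≤ x → 0 ≤ φ x) ∧ φ e = 1}

/-- Every positive unital linear functional is an element of `stateSpace e`. -/
theorem exists_mem_stateSpace [IsOrderedAddMonoid E] {e : E} (he : IsOrderUnitSpace e)
    (φ : E →ₗ[ℝ] ℝ) (hpos : ∀ x : E, 0 ≤ x → 0 ≤ φ x) (hunit : φ e = 1) :
    ∃ ψ ∈ stateSpace e, ∀ x : E, ψ x = φ x := by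
  have hmono : ∀ x y : E, x ≤ y → φ x ≤ φ y := fun x y h => by
    have := hpos (y - x) (sub_nonneg.2 h)
    rw [map_sub] at this
    linarith
  have hb : ∀ x : E, ‖φ x‖ ≤ 1 * ‖x‖ := fun x => by
    rw [one_mul, he.norm_eq x]
    refine le_csInf ?_ ?_
    · by_contra hne
      have hx : ‖x‖ = 0 := by
        rw [he.norm_eq x, Set.not_nonempty_iff_eq_empty.1 hne, Real.sInf_empty]
      have hx0 : x = 0 := norm_eq_zero.1 hx
      have he0 : ‖e‖ = 0 ∨ ∃ r : ℝ, 0 < r ∧ -(r • e) ≤ e := by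
        by_cases hn : ({r : ℝ | 0 < r ∧ -(r • e) ≤ e ∧ e ≤ r • e}).Nonempty
        · obtain ⟨r, hr, h, _⟩ := hn
          exact Or.inr ⟨r, hr, h⟩
        · left
          rw [he.norm_eq e, Set.not_nonempty_iff_eq_empty.1 hn, Real.sInf_empty]
      rcases he0 with h0 | ⟨q, hq, h⟩
      · have : e = 0 := norm_eq_zero.1 h0
        rw [this, map_zero] at hunit
        exact zero_ne_one hunit
      · have h5 : (0 : E) ≤ e + q • e := by
          have := add_le_add_left h (q • e)
          simpa [add_comm] using this
        have h6 : (0 : E) ≤ (1 + q) • e := by rwa [add_smul, one_smul]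
        exact hne ⟨1 + q, by linarith, by rw [hx0]; exact neg_nonpos.2 h6, by rwa [hx0]⟩
    · rintro r ⟨_, h1, h2⟩
      have h1' := hmono _ _ h1
      have h2' := hmono _ _ h2
      rw [map_neg, map_smul, hunit] at h1'
      rw [map_smul, hunit] at h2'
      simp only [smul_eq_mul, mul_one] at h1' h2'
      rw [Real.norm_eq_abs]
      exact abs_le.2 ⟨h1', h2'⟩
  exact ⟨StrongDual.toWeakDual (φ.mkContinuous 1 hb), ⟨hpos, hunit⟩, fun _ => rfl⟩

/-- The distance `ρ_L(σ, τ) = sup {|σ(x) - τ(x)| | L(x) ≤ 1}` of two functionals. -/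
def lipDist (L : E → ℝ≥0∞) (σ τ : WeakDual ℝ E) : ℝ≥0∞ :=
  ⨆ (x : E) (_ : L x ≤ 1), ‖σ x - τ x‖ₑ

/-- The restriction of `ρ_L` to the state space. -/
def stateDist (e : E) (L : E → ℝ≥0∞) (σ τ : stateSpace e) : ℝ≥0∞ :=
  lipDist L σ τ

/-- The restriction of `ρ_L` to the extreme boundary of the state space. -/
def boundaryDist (e : E) (L : E → ℝ≥0∞) (σ τ : (stateSpace e).extremePoints ℝ) : ℝ≥0∞ :=
  lipDist L σ τ

/-- `L` is a Lip-norm: a seminorm with values in `[0, ∞]` and with kernel `ℝe`, such that `ρ_L`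
induces the weak-* topology on the state space. -/
structure IsLipNorm (e : E) (L : E → ℝ≥0∞) : Prop where
  add_le : ∀ x y : E, L (x + y) ≤ L x + L y
  smul_eq : ∀ (r : ℝ) (x : E), L (r • x) = ‖r‖ₑ * L x
  ker_eq : ∀ x : E, L x = 0 ↔ ∃ r : ℝ, x = r • e
  isOpen_iff : ∀ U : Set (stateSpace e), IsOpen U ↔
    ∀ σ ∈ U, ∃ ε : ℝ≥0∞, 0 < ε ∧ ∀ τ : stateSpace e, stateDist e L σ τ < ε → τ ∈ U

/-- `L` is finite on a norm-dense subset. -/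
def DenselyFinite (L : E → ℝ≥0∞) : Prop := Dense {x : E | L x < ⊤}

/-- `(E, L)` is a compact quantum metric space with order unit `e`. -/
structure IsCQMS (e : E) (L : E → ℝ≥0∞) : Prop where
  orderUnitSpace : IsOrderUnitSpace e
  lipNorm : IsLipNorm e L

/-- `(E, L)` is a quantum metric Choquet simplex. -/
structure IsQMCS (e : E) (L : E → ℝ≥0∞) : Prop extends IsCQMS e L where
  complete : CompleteSpace E
  riesz : RieszInterpolation E
  lowerSemicontinuous : LowerSemicontinuous L
  denselyFinite : DenselyFinite L

/-- `(E, L)` is a quantum metric Bauer simplex: a quantum metric Choquet simplex whose state space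
is a Bauer simplex with `ρ_L(σ, τ) = W_{ρ_L}(μ_σ, μ_τ)` for all states `σ`, `τ`. -/
structure IsQMBS (e : E) (L : E → ℝ≥0∞) : Prop extends IsQMCS e L where
  bauer : IsBauerSimplex (stateSpace e)
  isometry : ∀ σ τ : stateSpace e,
    ∃ μ ν : MeasureTheory.ProbabilityMeasure ((stateSpace e).extremePoints ℝ),
      IsRepresentingMeasure μ σ ∧ IsRepresentingMeasure ν τ ∧
        stateDist e L σ τ = wasserstein (boundaryDist e L) μ ν

/-- Every Lipschitz function on the extreme boundary of the state space (with the metric `ρ_L`) has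
a unique continuous affine extension to the state space, and this extension increases neither the
uniform norm nor the Lipschitz seminorm. -/
def LipschitzExtension (e : E) (L : E → ℝ≥0∞) : Prop :=
  ∀ f : (stateSpace e).extremePoints ℝ → ℝ, lipSeminorm (boundaryDist e L) f < ⊤ →
    ∃ g : stateSpace e → ℝ, IsContAffine g ∧ (∀ σ, g (boundaryIncl σ) = f σ) ∧
      uniformNorm g ≤ uniformNorm f ∧
      lipSeminorm (stateDist e L) g ≤ lipSeminorm (boundaryDist e L) f ∧
      ∀ h : stateSpace e → ℝ, IsContAffine h → (∀ σ, h (boundaryIncl σ) = f σ) → h = g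

end OrderUnit

end

end QuantumMetric

/-!
States control the order unit space through three consequences of the Hahn–Banach theorem: they
detect the order (as do the pure states, by the Krein–Milman theorem), every continuous affine
function on the state space is evaluation at an element (Kadison,
`IsOrderUnitSpace.exists_eval_eq`), and every functional killing the unit is a multiple of a
difference of two states (`IsOrderUnitSpace.exists_sub_states`). The last fact gives `L(x) = L_ρ(x̂)`
on the whole state space for a lower semicontinuous Lip-norm (`IsLipNorm.le_lipSeminorm_eval`).

On a quantum metric Bauer simplex, a Lipschitz function `f` on the boundary extends to
`g(σ) = ∫ f dμ_σ`. Uniqueness of representing measures makes `g` affine, and the isometry with the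
Wasserstein metric makes it Lipschitz with the same constant, hence continuous
(`IsQMBS.lipschitzExtension`). Applied to `x̂` on the boundary, this gives the formula for `L`
(`IsQMBS.eq_lipSeminorm`).

Lipschitz extension yields elements restricting to `max(x̂, ŷ)` on the boundary, at first when
`L(x)` and `L(y)` are finite and then for all `x`, `y` by density and completeness
(`LipschitzExtension.exists_max`). These elements are suprema, so `E` is a vector lattice. The
identity `σ(z) = max(σ(x), σ(y))` passes to the closure of the boundary and forces `σ` to be pure
(`mem_extremePoints_of_max`), so the boundary is compact, and the Stone–Weierstrass theorem
identifies `E` with `C(∂S(E))`. The Riesz–Markov–Kakutani theorem then identifies the cone over the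
state space with the finite Borel measures on the boundary, as an ordered cone. Measures form a
lattice, so `S(E)` is a Bauer simplex with unique representing measures, and the isometry
is the comparison of two suprema in `LipschitzExtension.isometry`.
-/

namespace QuantumMetric

open MeasureTheory

/-! ### Order unit spaces and their states -/

section States

variable {E : Type*} [NormedAddCommGroup E] [NormedSpace ℝ E]

/-- Weak-* continuous functionals on the dual are evaluations. -/
theorem exists_eval_of_weakDual_dual (f : WeakDual ℝ E →L[ℝ] ℝ) :
    ∃ x : E, ∀ φ : WeakDual ℝ E, f φ = φ x := by
  obtain ⟨x, hx⟩ := LinearMap.dualEmbedding_surjective (topDualPairing ℝ E) f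
  exact ⟨x, fun φ => by rw [← hx]; rfl⟩

instance weakDual_locallyConvexSpace : LocallyConvexSpace ℝ (WeakDual ℝ E) :=
  inferInstanceAs (LocallyConvexSpace ℝ (WeakBilin (topDualPairing ℝ E)))

variable [PartialOrder E] {e : E}

theorem isContAffine_eval (x : E) :
    IsContAffine (K := stateSpace e) (fun σ => (σ : WeakDual ℝ E) x) where
  continuous := (WeakDual.eval_continuous x).comp continuous_subtype_val
  affine σ τ ω a b _ _ _ h := by rw [h]; rfl

theorem convex_stateSpace : Convex ℝ (stateSpace e) := by
  rintro σ ⟨hσ, hσe⟩ τ ⟨hτ, hτe⟩ a b ha hb hab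
  refine ⟨fun x hx => ?_, ?_⟩
  · exact add_nonneg (mul_nonneg ha (hσ x hx)) (mul_nonneg hb (hτ x hx))
  · change a * σ e + b * τ e = 1
    rw [hσe, hτe]
    linarith

theorem isClosed_stateSpace : IsClosed (stateSpace e) := by
  have : stateSpace e = (⋂ (x : E) (_ : 0 ≤ x), {φ : WeakDual ℝ E | 0 ≤ φ x}) ∩ {φ | φ e = 1} := by
    ext φ
    simp [stateSpace]
  rw [this]
  exact (isClosed_biInter fun x _ =>
    isClosed_le continuous_const (WeakDual.eval_continuous x)).inter
      (isClosed_eq (WeakDual.eval_continuous e) continuous_const)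

variable [IsOrderedAddMonoid E]

theorem state_mono {σ : WeakDual ℝ E} (hσ : σ ∈ stateSpace e) {x y : E} (h : x ≤ y) :
    σ x ≤ σ y := by
  have := hσ.1 (y - x) (sub_nonneg.2 h)
  rw [map_sub] at this
  linarith

variable [IsOrderedModule ℝ E]

namespace IsOrderUnitSpace

theorem unit_nonneg (he : IsOrderUnitSpace e) : 0 ≤ e := by
  obtain ⟨r, hr, h⟩ := he.order_unit (-e)
  have h1 : 0 ≤ (r + 1) • e := by
    rw [add_smul, one_smul]
    exact neg_le_iff_add_nonneg.1 h
  have := smul_nonneg (inv_nonneg.2 (by linarith : (0 : ℝ) ≤ r + 1)) h1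
  rwa [smul_smul, inv_mul_cancel₀ (by linarith), one_smul] at this

theorem le_norm_smul (he : IsOrderUnitSpace e) (x : E) : x ≤ ‖x‖ • e := by
  rw [← sub_nonpos]
  refine he.archimedean _ fun r hr => ?_
  have hne : ({r : ℝ | 0 < r ∧ -(r • e) ≤ x ∧ x ≤ r • e}).Nonempty := by
    obtain ⟨a, ha, hxa⟩ := he.order_unit x
    obtain ⟨b, hb, hxb⟩ := he.order_unit (-x)
    refine ⟨a + b + 1, by linarith, ?_, ?_⟩
    · exact neg_le.1 (hxb.trans (smul_le_smul_of_nonneg_right (by linarith) he.unit_nonneg))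
    · exact hxa.trans (smul_le_smul_of_nonneg_right (by linarith) he.unit_nonneg)
  obtain ⟨s, ⟨_, _, hs⟩, hsr⟩ := exists_lt_of_csInf_lt hne
    (show sInf _ < ‖x‖ + r by rw [← he.norm_eq x]; linarith)
  rw [sub_le_iff_le_add, ← add_smul, add_comm r]
  exact hs.trans (smul_le_smul_of_nonneg_right hsr.le he.unit_nonneg)

theorem neg_norm_smul_le (he : IsOrderUnitSpace e) (x : E) : -(‖x‖ • e) ≤ x := by
  have := he.le_norm_smul (-x)
  rw [norm_neg] at this
  exact neg_le.1 this

theorem norm_le_of_le_smul (he : IsOrderUnitSpace e) {x : E} {r : ℝ} (hr : 0 ≤ r)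
    (h1 : -(r • e) ≤ x) (h2 : x ≤ r • e) : ‖x‖ ≤ r := by
  refine le_of_forall_pos_le_add fun ε hε => ?_
  have h : r • e ≤ (r + ε) • e := smul_le_smul_of_nonneg_right (by linarith) he.unit_nonneg
  rw [he.norm_eq x]
  exact csInf_le ⟨0, fun s hs => hs.1.le⟩
    ⟨by linarith, (neg_le_neg h).trans h1, h2.trans h⟩

theorem isClosed_nonneg (he : IsOrderUnitSpace e) : IsClosed {x : E | 0 ≤ x} := by
  refine isClosed_of_closure_subset fun x hx => ?_
  have h : -x ≤ 0 := by
    refine he.archimedean _ fun r hr => ?_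
    obtain ⟨y, hy, hxy⟩ := Metric.mem_closure_iff.1 hx r hr
    rw [dist_eq_norm, ← norm_neg, neg_sub] at hxy
    calc -x ≤ y - x := by
            have hy' : (0 : E) ≤ y := hy
            simpa [sub_eq_add_neg] using hy'
      _ ≤ ‖y - x‖ • e := he.le_norm_smul _
      _ ≤ r • e := smul_le_smul_of_nonneg_right hxy.le he.unit_nonneg
  exact neg_nonpos.1 h

/-- Separation of a point from the closed positive cone: states detect positivity. -/
theorem exists_state_neg (he : IsOrderUnitSpace e) {x : E} (hx : ¬ 0 ≤ x) :
    ∃ σ ∈ stateSpace e, σ x < 0 := by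
  have hconv : Convex ℝ {y : E | 0 ≤ y} := convex_Ici (𝕜 := ℝ) (0 : E)
  obtain ⟨f, u, hfx, hf⟩ := geometric_hahn_banach_point_closed hconv he.isClosed_nonneg hx
  have hu : u < 0 := by simpa using hf 0 (le_refl (0 : E))
  have hpos : ∀ y : E, 0 ≤ y → 0 ≤ f y := by
    intro y hy
    by_contra! hneg
    -- a negative value could be scaled below the separating level `u`
    have := hf ((u / f y) • y) (smul_nonneg (div_nonneg_of_nonpos hu.le hneg.le) hy)
    rw [map_smul, smul_eq_mul, div_mul_cancel₀ _ hneg.ne] at this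
    exact lt_irrefl _ this
  have hmono : ∀ y z : E, y ≤ z → f y ≤ f z := fun y z h => by
    have := hpos _ (sub_nonneg.2 h)
    rw [map_sub] at this
    linarith
  have hfe : 0 < f e := by
    have h0 := hpos e he.unit_nonneg
    rcases h0.lt_or_eq with h | h
    · exact h
    · have := hmono _ _ (he.neg_norm_smul_le x)
      rw [map_neg, map_smul, ← h, smul_zero] at this
      linarith
  refine ⟨StrongDual.toWeakDual ((f e)⁻¹ • f), ⟨fun y hy => ?_, ?_⟩, ?_⟩
  · exact mul_nonneg (inv_nonneg.2 hfe.le) (hpos y hy)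
  · exact inv_mul_cancel₀ hfe.ne'
  · exact mul_neg_of_pos_of_neg (inv_pos.2 hfe) (hfx.trans hu)

theorem le_of_states (he : IsOrderUnitSpace e) {x y : E} (h : ∀ σ ∈ stateSpace e, σ x ≤ σ y) :
    x ≤ y := by
  by_contra hxy
  obtain ⟨σ, hσ, hlt⟩ := he.exists_state_neg (x := y - x) (by rwa [sub_nonneg])
  rw [map_sub] at hlt
  linarith [h σ hσ]

theorem abs_state_le_norm (he : IsOrderUnitSpace e) {σ : WeakDual ℝ E} (hσ : σ ∈ stateSpace e)
    (x : E) : |σ x| ≤ ‖x‖ := by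
  have h1 := state_mono hσ (he.neg_norm_smul_le x)
  have h2 := state_mono hσ (he.le_norm_smul x)
  rw [map_neg] at h1
  rw [map_smul, hσ.2, smul_eq_mul, mul_one] at h1 h2
  exact abs_le.2 ⟨h1, h2⟩

theorem isCompact_stateSpace (he : IsOrderUnitSpace e) : IsCompact (stateSpace e) := by
  refine WeakDual.isCompact_of_bounded_of_closed ?_ isClosed_stateSpace
  have : stateSpace e ⊆ WeakDual.toStrongDual ⁻¹' Metric.closedBall 0 1 := by
    intro σ hσ
    rw [Set.mem_preimage, mem_closedBall_zero_iff]
    refine ContinuousLinearMap.opNorm_le_bound _ zero_le_one fun x => ?_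
    rw [one_mul]
    exact he.abs_state_le_norm hσ x
  exact (Metric.isBounded_closedBall (α := StrongDual ℝ E)).subset this

/-- By the Krein–Milman theorem, pure states already detect the order. -/
theorem le_of_extremePoints (he : IsOrderUnitSpace e) {x y : E}
    (h : ∀ σ ∈ (stateSpace e).extremePoints ℝ, σ x ≤ σ y) : x ≤ y := by
  refine he.le_of_states fun σ hσ => ?_
  rw [← closure_convexHull_extremePoints he.isCompact_stateSpace convex_stateSpace] at hσ
  have hclosed : IsClosed {φ : WeakDual ℝ E | φ x ≤ φ y} :=
    isClosed_le (WeakDual.eval_continuous x) (WeakDual.eval_continuous y)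
  have hconv : Convex ℝ {φ : WeakDual ℝ E | φ x ≤ φ y} := by
    intro φ hφ ψ hψ a b ha hb _
    exact add_le_add (mul_le_mul_of_nonneg_left hφ ha) (mul_le_mul_of_nonneg_left hψ hb)
  exact closure_minimal (convexHull_min h hconv) hclosed hσ

theorem norm_le_of_extremePoints (he : IsOrderUnitSpace e) {x : E} {r : ℝ} (hr : 0 ≤ r)
    (h : ∀ σ ∈ (stateSpace e).extremePoints ℝ, |σ x| ≤ r) : ‖x‖ ≤ r := by
  refine he.norm_le_of_le_smul hr (he.le_of_extremePoints fun σ hσ => ?_)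
    (he.le_of_extremePoints fun σ hσ => ?_)
  · rw [map_neg, map_smul, (extremePoints_subset hσ).2, smul_eq_mul, mul_one]
    exact (abs_le.1 (h σ hσ)).1
  · rw [map_smul, (extremePoints_subset hσ).2, smul_eq_mul, mul_one]
    exact (abs_le.1 (h σ hσ)).2

theorem stateSpace_nonempty (he : IsOrderUnitSpace e) {x : E} (hx : x ≠ 0) :
    (stateSpace e).Nonempty := by
  by_contra h
  rw [Set.not_nonempty_iff_eq_empty] at h
  exact hx (le_antisymm (he.le_of_states (by simp [h])) (he.le_of_states (by simp [h])))

/-- The separation step in Kadison's theorem: the graphs of `g` and `g + ε` are disjoint compact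
convex sets, and a hyperplane between them is the graph of an evaluation up to a constant. -/
theorem exists_eval_near (he : IsOrderUnitSpace e) {g : stateSpace e → ℝ} (hg : IsContAffine g)
    {ε : ℝ} (hε : 0 < ε) : ∃ x : E, ∀ σ : stateSpace e, |g σ - (σ : WeakDual ℝ E) x| ≤ ε := by
  rcases isEmpty_or_nonempty (stateSpace e) with hS | ⟨⟨σ₀⟩⟩
  · exact ⟨0, fun σ => (hS.false σ).elim⟩
  have : CompactSpace (stateSpace e) := isCompact_iff_compactSpace.1 he.isCompact_stateSpace
  let G : ℝ → Set (WeakDual ℝ E × ℝ) := fun c =>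
    Set.range fun σ : stateSpace e => ((σ : WeakDual ℝ E), g σ + c)
  have hGc : ∀ c, IsCompact (G c) := fun c =>
    isCompact_range (continuous_subtype_val.prodMk (hg.continuous.add continuous_const))
  have hGv : ∀ c, Convex ℝ (G c) := by
    rintro c _ ⟨σ, rfl⟩ _ ⟨τ, rfl⟩ a b ha hb hab
    refine ⟨⟨_, convex_stateSpace σ.2 τ.2 ha hb hab⟩, ?_⟩
    refine Prod.ext rfl ?_
    change g _ + c = a * (g σ + c) + b * (g τ + c)
    rw [hg.affine σ τ _ a b ha hb hab rfl]
    linear_combination (-c) * hab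
  have hdisj : Disjoint (G 0) (G ε) := by
    rw [Set.disjoint_left]
    rintro _ ⟨σ, rfl⟩ ⟨τ, hτ⟩
    simp only [Prod.mk.injEq] at hτ
    have : τ = σ := Subtype.ext hτ.1
    rw [this] at hτ
    linarith [hτ.2]
  obtain ⟨f, u, v, h1, huv, h2⟩ :=
    geometric_hahn_banach_compact_closed (hGv 0) (hGc 0) (hGv ε) (hGc ε).isClosed hdisj
  obtain ⟨x, hx⟩ := exists_eval_of_weakDual_dual (f.comp (ContinuousLinearMap.inl ℝ _ ℝ))
  set c := f (0, 1) with hc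
  have hf : ∀ (φ : WeakDual ℝ E) (t : ℝ), f (φ, t) = φ x + c * t := by
    intro φ t
    have h3 : ((φ, t) : WeakDual ℝ E × ℝ) = (φ, 0) + t • ((0 : WeakDual ℝ E), (1 : ℝ)) := by
      simp
    have h4 : f (φ, 0) = φ x := hx φ
    rw [h3, map_add, map_smul, h4, ← hc, smul_eq_mul, mul_comm]
  have hlow : ∀ σ : stateSpace e, (σ : WeakDual ℝ E) x + c * g σ < u := fun σ => by
    have := h1 _ ⟨σ, rfl⟩
    rwa [hf, add_zero] at this
  have hup : ∀ σ : stateSpace e, v < (σ : WeakDual ℝ E) x + c * (g σ + ε) := fun σ => by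
    have := h2 _ ⟨σ, rfl⟩
    rwa [hf] at this
  have hcpos : 0 < c := by
    have := hlow σ₀
    have := hup σ₀
    by_contra! hneg
    nlinarith
  refine ⟨c⁻¹ • (u • e - x), fun σ => ?_⟩
  have h5 : (σ : WeakDual ℝ E) (c⁻¹ • (u • e - x)) = (u - (σ : WeakDual ℝ E) x) / c := by
    rw [map_smul, map_sub, map_smul, σ.2.2, smul_eq_mul, smul_eq_mul, mul_one, inv_mul_eq_div]
  have h6 := hlow σ
  have h7 := hup σ
  rw [h5, abs_le]
  constructor
  · rw [neg_le_sub_iff_le_add, div_le_iff₀ hcpos]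
    nlinarith
  · have : g σ ≤ (u - (σ : WeakDual ℝ E) x) / c := by
      rw [le_div_iff₀ hcpos]
      nlinarith
    linarith

/-- **Kadison's theorem**: in a complete order unit space, every continuous affine function on the
state space is evaluation at an element. -/
theorem exists_eval_eq [CompleteSpace E] (he : IsOrderUnitSpace e) {g : stateSpace e → ℝ}
    (hg : IsContAffine g) : ∃ x : E, ∀ σ : stateSpace e, g σ = (σ : WeakDual ℝ E) x := by
  choose x hx using fun n : ℕ => he.exists_eval_near hg (Nat.one_div_pos_of_nat (α := ℝ) (n := n))
  have hlim := tendsto_one_div_add_atTop_nhds_zero_nat (𝕜 := ℝ)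
  have hcauchy : CauchySeq x := by
    refine cauchySeq_of_le_tendsto_0 (fun N : ℕ => 1 / ((N : ℝ) + 1) + 1 / ((N : ℝ) + 1))
      (fun n m N hn hm => ?_) (by simpa using hlim.add hlim)
    have hN : ∀ k : ℕ, N ≤ k → 1 / ((k : ℝ) + 1) ≤ 1 / ((N : ℝ) + 1) := fun k hk =>
      Nat.one_div_le_one_div hk
    rw [dist_eq_norm]
    refine he.norm_le_of_extremePoints (by positivity) fun σ hσ => ?_
    have h1 := hx n ⟨σ, extremePoints_subset hσ⟩
    have h2 := hx m ⟨σ, extremePoints_subset hσ⟩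
    have h3 := hN n hn
    have h4 := hN m hm
    rw [abs_le] at *
    rw [map_sub]
    constructor <;> linarith
  obtain ⟨z, hz⟩ := cauchySeq_tendsto_of_complete hcauchy
  refine ⟨z, fun σ => ?_⟩
  have hσz : Filter.Tendsto (fun n => (σ : WeakDual ℝ E) (x n)) Filter.atTop
      (nhds ((σ : WeakDual ℝ E) z)) :=
    ((WeakDual.toStrongDual (σ : WeakDual ℝ E)).continuous.tendsto z).comp hz
  have hσg : Filter.Tendsto (fun n => g σ - (σ : WeakDual ℝ E) (x n)) Filter.atTop (nhds 0) :=
    squeeze_zero_norm (fun n => hx n σ) hlim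
  have := tendsto_nhds_unique hσg (tendsto_const_nhds.sub hσz)
  linarith

open scoped Pointwise in
/-- Jordan decomposition: a functional of norm at most `2` that vanishes on the unit is a
difference of two states. Otherwise an element `x` separates it from the compact convex set of such
differences, on which `x` is bounded by the width of its numerical range. -/
theorem exists_sub_states (he : IsOrderUnitSpace e) (hne : (stateSpace e).Nonempty)
    (φ : StrongDual ℝ E) (hφe : φ e = 0) (hφ : ‖φ‖ ≤ 2) :
    ∃ σ ∈ stateSpace e, ∃ τ ∈ stateSpace e, ∀ x, φ x = σ x - τ x := by
  have hmem : StrongDual.toWeakDual φ ∈ stateSpace e - stateSpace e := by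
    by_contra hnot
    have hcompact : IsCompact (stateSpace e - stateSpace e) := by
      rw [sub_eq_add_neg]
      exact he.isCompact_stateSpace.add he.isCompact_stateSpace.neg
    obtain ⟨f, u, hf, hfu⟩ := geometric_hahn_banach_closed_point
      (convex_stateSpace.sub convex_stateSpace)
      hcompact.isClosed hnot
    obtain ⟨x, hx⟩ := exists_eval_of_weakDual_dual f
    obtain ⟨σ, hσ, hmax⟩ := he.isCompact_stateSpace.exists_isMaxOn hne
      (WeakDual.eval_continuous x).continuousOn
    obtain ⟨τ, hτ, hmin⟩ := he.isCompact_stateSpace.exists_isMinOn hne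
      (WeakDual.eval_continuous x).continuousOn
    -- translating `x` to the midpoint of its numerical range makes its norm half the width
    have hnorm : ‖x - ((σ x + τ x) / 2) • e‖ ≤ (σ x - τ x) / 2 := by
      have h0 : τ x ≤ σ x := hmax hτ
      refine he.norm_le_of_extremePoints (by linarith) fun ω hω => ?_
      have hω := extremePoints_subset hω
      have h1 : ω x ≤ σ x := hmax hω
      have h2 : τ x ≤ ω x := hmin hω
      rw [map_sub, map_smul, hω.2, smul_eq_mul, mul_one, abs_le]
      constructor <;> linarith
    have h1 : φ x ≤ 2 * ((σ x - τ x) / 2) := by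
      have h2 : φ (x - ((σ x + τ x) / 2) • e) = φ x := by
        rw [map_sub, map_smul, hφe, smul_zero, sub_zero]
      rw [← h2]
      exact (le_abs_self _).trans ((φ.le_opNorm _).trans
        (mul_le_mul hφ hnorm (norm_nonneg _) zero_le_two))
    have h3 : f (σ - τ) = σ x - τ x := hx _
    have h4 := hf _ (Set.sub_mem_sub hσ hτ)
    have h5 : f (StrongDual.toWeakDual φ) = φ x := hx _
    linarith
  obtain ⟨σ, hσ, τ, hτ, h⟩ := hmem
  exact ⟨σ, hσ, τ, hτ, fun x => (DFunLike.congr_fun h x).symm⟩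

end IsOrderUnitSpace

end States

/-! ### The metric of a Lip-norm -/

theorem lipSeminorm_le_iff {X : Type*} {d : X → X → ℝ≥0∞} (h0 : ∀ x y, x ≠ y → d x y ≠ 0)
    (htop : ∀ x y, d x y ≠ ⊤) (f : X → ℝ) (c : ℝ≥0∞) :
    lipSeminorm d f ≤ c ↔ ∀ x y, ‖f x - f y‖ₑ ≤ c * d x y := by
  simp only [lipSeminorm, iSup_le_iff]
  refine forall₂_congr fun x y => ⟨fun h => ?_, fun h hxy => ?_⟩
  · by_cases hxy : x = y
    · simp [hxy]
    · exact (ENNReal.div_le_iff (h0 x y hxy) (htop x y)).1 (h hxy)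
  · exact (ENNReal.div_le_iff (h0 x y hxy) (htop x y)).2 h

theorem continuous_boundaryIncl {V : Type*} [AddCommGroup V] [Module ℝ V] [TopologicalSpace V]
    {K : Set V} : Continuous (boundaryIncl (K := K)) :=
  continuous_subtype_val.subtype_mk _

section Metric

variable {E : Type*} [NormedAddCommGroup E] [NormedSpace ℝ E] {L : E → ℝ≥0∞}

theorem lipDist_self (σ : WeakDual ℝ E) : lipDist L σ σ = 0 := by
  simp [lipDist]

theorem lipDist_comm (σ τ : WeakDual ℝ E) : lipDist L σ τ = lipDist L τ σ := by
  simp only [lipDist, enorm_sub_rev]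

theorem lipDist_triangle (σ τ ω : WeakDual ℝ E) :
    lipDist L σ ω ≤ lipDist L σ τ + lipDist L τ ω := by
  refine iSup₂_le fun x hx => ?_
  have h : σ x - ω x = (σ x - τ x) + (τ x - ω x) := by ring
  rw [h]
  exact (enorm_add_le _ _).trans (add_le_add (le_iSup₂ (f := fun x (_ : L x ≤ 1) => ‖σ x - τ x‖ₑ)
    x hx) (le_iSup₂ (f := fun x (_ : L x ≤ 1) => ‖τ x - ω x‖ₑ) x hx))

namespace IsLipNorm

variable [PartialOrder E] {e : E}

theorem map_zero (hL : IsLipNorm e L) : L 0 = 0 := (hL.ker_eq 0).2 ⟨0, by simp⟩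

theorem enorm_sub_le (hL : IsLipNorm e L) {σ τ : WeakDual ℝ E} (hσ : σ ∈ stateSpace e)
    (hτ : τ ∈ stateSpace e) {x : E} (hx : L x < ⊤) :
    ‖σ x - τ x‖ₑ ≤ L x * lipDist L σ τ := by
  by_cases h0 : L x = 0
  · obtain ⟨r, rfl⟩ := (hL.ker_eq x).1 h0
    simp [hσ.2, hτ.2]
  have hr : 0 < (L x).toReal := ENNReal.toReal_pos h0 hx.ne
  have hrL : ‖(L x).toReal‖ₑ = L x := by
    rw [Real.enorm_eq_ofReal hr.le, ENNReal.ofReal_toReal hx.ne]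
  have hy : L ((L x).toReal⁻¹ • x) ≤ 1 := by
    rw [hL.smul_eq, enorm_inv hr.ne', hrL, ENNReal.inv_mul_cancel h0 hx.ne]
  have h := le_iSup₂ (f := fun x (_ : L x ≤ 1) => ‖σ x - τ x‖ₑ) _ hy
  have h2 : σ x - τ x = (L x).toReal *
      (σ ((L x).toReal⁻¹ • x) - τ ((L x).toReal⁻¹ • x)) := by
    rw [map_smul, map_smul, smul_eq_mul, smul_eq_mul]
    field_simp
  rw [h2, enorm_mul, hrL]
  exact mul_le_mul_right h _

theorem isOpen_ball (hL : IsLipNorm e L) (σ : stateSpace e) (r : ℝ≥0∞) :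
    IsOpen {τ | stateDist e L σ τ < r} := by
  refine (hL.isOpen_iff _).2 fun τ hτ => ⟨r - stateDist e L σ τ, tsub_pos_of_lt hτ, fun ω hω => ?_⟩
  refine (lipDist_triangle (L := L) (σ : WeakDual ℝ E) τ ω).trans_lt ?_
  exact lt_tsub_iff_left.1 hω

/-- The state space is connected, so the extended metric is finite. -/
theorem lipDist_ne_top (hL : IsLipNorm e L) {σ τ : WeakDual ℝ E} (hσ : σ ∈ stateSpace e)
    (hτ : τ ∈ stateSpace e) : lipDist L σ τ ≠ ⊤ := by
  have : PreconnectedSpace (stateSpace e) :=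
    Subtype.preconnectedSpace convex_stateSpace.isPreconnected
  have hclosed : IsOpen {ω : stateSpace e | stateDist e L ⟨σ, hσ⟩ ω < ⊤}ᶜ := by
    refine (hL.isOpen_iff _).2 fun ω hω => ⟨1, one_pos, fun ω' hω' hlt => hω ?_⟩
    have h1 : lipDist L σ (ω' : WeakDual ℝ E) < ⊤ := hlt
    have h2 : lipDist L (ω' : WeakDual ℝ E) ω < ⊤ := by
      rw [lipDist_comm]
      exact lt_of_lt_of_le hω' le_top
    exact (lipDist_triangle (L := L) σ (ω' : WeakDual ℝ E) ω).trans_lt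
      (ENNReal.add_lt_top.2 ⟨h1, h2⟩)
  have hmem : (⟨σ, hσ⟩ : stateSpace e) ∈ {ω : stateSpace e | stateDist e L ⟨σ, hσ⟩ ω < ⊤} := by
    change lipDist L σ σ < ⊤
    rw [lipDist_self]
    exact ENNReal.zero_lt_top
  have huniv := IsClopen.eq_univ ⟨⟨hclosed⟩, hL.isOpen_ball _ _⟩ ⟨_, hmem⟩
  have hτ' : (⟨τ, hτ⟩ : stateSpace e) ∈ {ω : stateSpace e | stateDist e L ⟨σ, hσ⟩ ω < ⊤} := by
    rw [huniv]
    trivial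
  exact ne_of_lt hτ'

theorem lipDist_ne_zero (hL : IsLipNorm e L) (hdense : DenselyFinite L) {σ τ : WeakDual ℝ E}
    (hσ : σ ∈ stateSpace e) (hτ : τ ∈ stateSpace e) (hne : σ ≠ τ) : lipDist L σ τ ≠ 0 := by
  intro h0
  apply hne
  have heq : Set.EqOn σ τ {x | L x < ⊤} := fun x hx => by
    have := hL.enorm_sub_le hσ hτ hx
    rw [h0, mul_zero, nonpos_iff_eq_zero, enorm_eq_zero, sub_eq_zero] at this
    exact this
  have := Continuous.ext_on hdense (WeakDual.toStrongDual σ).continuous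
    (WeakDual.toStrongDual τ).continuous heq
  exact DFunLike.coe_injective this

theorem continuous_of_enorm_sub_le (hL : IsLipNorm e L) {X : Type*} [TopologicalSpace X]
    {i : X → stateSpace e} (hi : Continuous i) {f : X → ℝ} {c : ℝ≥0∞} (hc : c ≠ ⊤)
    (hf : ∀ x y, ‖f x - f y‖ₑ ≤ c * stateDist e L (i x) (i y)) : Continuous f := by
  rw [continuous_iff_continuousAt]
  intro x
  have hd : Filter.Tendsto (fun y => stateDist e L (i x) (i y)) (nhds x) (nhds 0) := by
    refine ENNReal.tendsto_nhds_zero.2 fun ε hε => ?_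
    have hopen := (hL.isOpen_ball (i x) ε).preimage hi
    filter_upwards [hopen.mem_nhds (by simpa [stateDist, lipDist_self] using hε)] with y hy
    exact le_of_lt hy
  have hcd := ENNReal.Tendsto.const_mul hd (Or.inr hc)
  rw [mul_zero] at hcd
  refine tendsto_iff_edist_tendsto_0.2 (tendsto_of_tendsto_of_tendsto_of_le_of_le
    tendsto_const_nhds hcd (fun _ => zero_le) fun y => ?_)
  rw [edist_comm, edist_eq_enorm_sub]
  exact hf x y

theorem lipSeminorm_stateDist_le_iff (hL : IsLipNorm e L) (hdense : DenselyFinite L)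
    (f : stateSpace e → ℝ) (c : ℝ≥0∞) :
    lipSeminorm (stateDist e L) f ≤ c ↔ ∀ σ τ, ‖f σ - f τ‖ₑ ≤ c * stateDist e L σ τ :=
  lipSeminorm_le_iff
    (fun σ τ h => hL.lipDist_ne_zero hdense σ.2 τ.2 fun h' => h (Subtype.ext h'))
    (fun σ τ => hL.lipDist_ne_top σ.2 τ.2) f c

theorem lipSeminorm_boundaryDist_le_iff (hL : IsLipNorm e L) (hdense : DenselyFinite L)
    (f : (stateSpace e).extremePoints ℝ → ℝ) (c : ℝ≥0∞) :
    lipSeminorm (boundaryDist e L) f ≤ c ↔ ∀ σ τ, ‖f σ - f τ‖ₑ ≤ c * boundaryDist e L σ τ :=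
  lipSeminorm_le_iff
    (fun σ τ h => hL.lipDist_ne_zero hdense (extremePoints_subset σ.2) (extremePoints_subset τ.2)
      fun h' => h (Subtype.ext h'))
    (fun σ τ => hL.lipDist_ne_top (extremePoints_subset σ.2) (extremePoints_subset τ.2)) f c

theorem continuous_of_lipSeminorm_lt_top (hL : IsLipNorm e L) (hdense : DenselyFinite L)
    {f : (stateSpace e).extremePoints ℝ → ℝ} (hf : lipSeminorm (boundaryDist e L) f < ⊤) :
    Continuous f :=
  hL.continuous_of_enorm_sub_le continuous_boundaryIncl hf.ne
    ((hL.lipSeminorm_boundaryDist_le_iff hdense f _).1 le_rfl)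

theorem lipSeminorm_eval_boundary_le (hL : IsLipNorm e L) (hdense : DenselyFinite L) (x : E) :
    lipSeminorm (boundaryDist e L) (fun σ => (σ : WeakDual ℝ E) x) ≤ L x := by
  rcases eq_top_or_lt_top (L x) with h | h
  · rw [h]
    exact le_top
  · exact (hL.lipSeminorm_boundaryDist_le_iff hdense _ _).2 fun σ τ =>
      hL.enorm_sub_le (extremePoints_subset σ.2) (extremePoints_subset τ.2) h

variable [IsOrderedAddMonoid E] [IsOrderedModule ℝ E]

/-- A lower semicontinuous Lip-norm is dominated by the Lipschitz seminorm of its own metric: a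
functional separating `x` from the closed convex set `{L ≤ 1}` kills the unit, hence is a multiple
of a difference of two states, and these two states witness the slope of `x`. -/
theorem le_lipSeminorm_eval (hL : IsLipNorm e L) (he : IsOrderUnitSpace e)
    (hdense : DenselyFinite L) (hlsc : LowerSemicontinuous L) (x : E) :
    L x ≤ lipSeminorm (stateDist e L) (fun σ => (σ : WeakDual ℝ E) x) := by
  by_contra! hlt
  obtain ⟨r, hcr, hrL⟩ := ENNReal.lt_iff_exists_nnreal_btwn.1 hlt
  have hr : (0 : ℝ) < r := NNReal.coe_pos.2 (ENNReal.coe_pos.1 (zero_le.trans_lt hcr))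
  have hx0 : x ≠ 0 := by
    rintro rfl
    rw [hL.map_zero] at hrL
    exact not_lt_zero hrL
  have hre : ‖(r : ℝ)‖ₑ = r := by
    rw [Real.enorm_eq_ofReal hr.le, ENNReal.ofReal_coe_nnreal]
  set y : E := (r : ℝ)⁻¹ • x with hy
  have hxy : x = (r : ℝ) • y := by rw [hy, smul_smul, mul_inv_cancel₀ hr.ne', one_smul]
  have hLy : y ∉ {z | L z ≤ 1} := by
    intro (hy1 : L y ≤ 1)
    have h1 : L x = r * L y := by rw [hxy, hL.smul_eq, hre]
    rw [h1] at hrL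
    exact absurd (mul_le_mul_right hy1 (r : ℝ≥0∞)) (by simpa using hrL)
  have hconv : Convex ℝ {z | L z ≤ 1} := by
    intro z hz w hw a b ha hb hab
    calc L (a • z + b • w) ≤ L (a • z) + L (b • w) := hL.add_le _ _
      _ = ‖a‖ₑ * L z + ‖b‖ₑ * L w := by rw [hL.smul_eq, hL.smul_eq]
      _ ≤ ‖a‖ₑ * 1 + ‖b‖ₑ * 1 := add_le_add (mul_le_mul_right hz _) (mul_le_mul_right hw _)
      _ = 1 := by
        rw [mul_one, mul_one, Real.enorm_eq_ofReal ha, Real.enorm_eq_ofReal hb,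
          ← ENNReal.ofReal_add ha hb, hab, ENNReal.ofReal_one]
  obtain ⟨f, u, hf, hfy⟩ := geometric_hahn_banach_closed_point hconv
    (hlsc.isClosed_preimage 1) hLy
  have hu : 0 < u := by
    have h1 := hf 0 (by simp [hL.map_zero])
    rwa [_root_.map_zero] at h1
  have hfe : f e = 0 := by
    by_contra hne
    -- `{L ≤ 1}` contains the whole line through the unit
    have h1 := hf ((u / f e) • e) (by
      have : L ((u / f e) • e) = 0 := (hL.ker_eq _).2 ⟨_, rfl⟩
      simp [this])
    rw [map_smul, smul_eq_mul, div_mul_cancel₀ _ hne] at h1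
    exact lt_irrefl _ h1
  have habs : ∀ z, L z ≤ 1 → |f z| ≤ u := by
    intro z hz
    refine abs_le.2 ⟨?_, (hf z hz).le⟩
    have h1 := hf ((-1 : ℝ) • z) (by
      change L _ ≤ 1
      rw [hL.smul_eq]
      simpa using hz)
    rw [map_smul, smul_eq_mul] at h1
    linarith
  have hf0 : 0 < ‖f‖ := by
    refine norm_pos_iff.2 fun h => ?_
    rw [h] at hfy
    exact absurd hfy hu.le.not_gt
  obtain ⟨σ, hσ, τ, hτ, hστ⟩ := he.exists_sub_states (he.stateSpace_nonempty hx0) (‖f‖⁻¹ • f)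
    (by simp [hfe]) (by rw [norm_smul, norm_inv, norm_norm, inv_mul_cancel₀ hf0.ne']; norm_num)
  have hval : ∀ z, σ z - τ z = f z / ‖f‖ := fun z => by
    rw [← hστ z, div_eq_inv_mul]
    rfl
  have hρ : lipDist L σ τ ≤ ENNReal.ofReal (u / ‖f‖) := by
    refine iSup₂_le fun z hz => ?_
    rw [hval, Real.enorm_eq_ofReal_abs, abs_div, abs_norm]
    exact ENNReal.ofReal_le_ofReal (div_le_div_of_nonneg_right (habs z hz) hf0.le)
  have hmain := (hL.lipSeminorm_stateDist_le_iff hdense _ _).1 hcr.le ⟨σ, hσ⟩ ⟨τ, hτ⟩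
  have hcontra : ‖σ x - τ x‖ₑ ≤ ENNReal.ofReal (r * (u / ‖f‖)) := by
    rw [ENNReal.ofReal_mul hr.le, ENNReal.ofReal_coe_nnreal]
    exact hmain.trans (mul_le_mul_right hρ _)
  rw [hval, hxy, map_smul, smul_eq_mul, Real.enorm_eq_ofReal_abs,
    ENNReal.ofReal_le_ofReal_iff (by positivity)] at hcontra
  have h1 := (le_abs_self _).trans hcontra
  rw [mul_div_assoc, mul_le_mul_iff_right₀ hr, div_le_div_iff_of_pos_right hf0] at h1
  linarith

end IsLipNorm

end Metric

/-! ### Representing measures on a compact extreme boundary -/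

theorem integrable_of_compactSpace {X : Type*} [TopologicalSpace X] [CompactSpace X]
    [MeasurableSpace X] [OpensMeasurableSpace X] {f : X → ℝ} (hf : Continuous f)
    (μ : Measure X) [IsFiniteMeasure μ] : Integrable f μ :=
  hf.integrable_of_hasCompactSupport (HasCompactSupport.of_compactSpace f)

theorem enorm_integral_sub_le_wasserstein {X : Type*} [MeasurableSpace X] {d : X → X → ℝ≥0∞}
    (μ ν : ProbabilityMeasure X) {f : X → ℝ} {c : ℝ≥0∞} (hc : c ≠ ⊤)
    (hf : ∀ x y, ‖f x - f y‖ₑ ≤ c * d x y) :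
    ‖(∫ x, f x ∂(μ : Measure X)) - ∫ x, f x ∂(ν : Measure X)‖ₑ ≤ c * wasserstein d μ ν := by
  by_cases h0 : c = 0
  · have hX : Nonempty X := by
      by_contra h
      rw [not_nonempty_iff] at h
      exact IsProbabilityMeasure.ne_zero (μ : Measure X) (Measure.eq_zero_of_isEmpty _)
    obtain ⟨x₀⟩ := hX
    have hconst : f = fun _ => f x₀ := by
      funext x
      have := hf x x₀
      rwa [h0, zero_mul, nonpos_iff_eq_zero, enorm_eq_zero, sub_eq_zero] at this
    rw [hconst]
    simp
  have hr : 0 < c.toReal := ENNReal.toReal_pos h0 hc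
  have hrc : ‖c.toReal‖ₑ = c := by rw [Real.enorm_eq_ofReal hr.le, ENNReal.ofReal_toReal hc]
  have hfeas : ∀ x y, ‖c.toReal⁻¹ * f x - c.toReal⁻¹ * f y‖ₑ ≤ d x y := fun x y => by
    rw [← mul_sub, enorm_mul, enorm_inv hr.ne', hrc]
    calc c⁻¹ * ‖f x - f y‖ₑ ≤ c⁻¹ * (c * d x y) := mul_le_mul_right (hf x y) _
      _ = d x y := by rw [← mul_assoc, ENNReal.inv_mul_cancel h0 hc, one_mul]
  have h : ‖(∫ x, c.toReal⁻¹ * f x ∂(μ : Measure X)) -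
      ∫ x, c.toReal⁻¹ * f x ∂(ν : Measure X)‖ₑ ≤ wasserstein d μ ν :=
    le_iSup₂ (f := fun (f : X → ℝ) (_ : ∀ x y, ‖f x - f y‖ₑ ≤ d x y) =>
      ‖(∫ x, f x ∂(μ : Measure X)) - ∫ x, f x ∂(ν : Measure X)‖ₑ) _ hfeas
  rw [integral_const_mul, integral_const_mul, ← mul_sub, enorm_mul, enorm_inv hr.ne', hrc] at h
  calc ‖(∫ x, f x ∂(μ : Measure X)) - ∫ x, f x ∂(ν : Measure X)‖ₑ
      = c * (c⁻¹ * ‖(∫ x, f x ∂(μ : Measure X)) - ∫ x, f x ∂(ν : Measure X)‖ₑ) := by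
        rw [← mul_assoc, ENNReal.mul_inv_cancel h0 hc, one_mul]
    _ ≤ c * wasserstein d μ ν := mul_le_mul_right h _

section Represents

variable {V : Type*} [AddCommGroup V] [Module ℝ V] [TopologicalSpace V] {K : Set V}

theorem represents_dirac (x : K.extremePoints ℝ) :
    Represents ⟨Measure.dirac x, Measure.dirac.isProbabilityMeasure⟩ (boundaryIncl x) := by
  intro f hf
  have hcont : Continuous fun y : K.extremePoints ℝ => f (boundaryIncl y) :=
    hf.continuous.comp continuous_boundaryIncl
  exact (integral_dirac' _ _ hcont.stronglyMeasurable).symm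

/-- A convex combination of points is represented by the convex combination of measures. -/
theorem Represents.exists_convexCombination [CompactSpace (K.extremePoints ℝ)] {x y z : K}
    {μ ν : ProbabilityMeasure (K.extremePoints ℝ)} (hμ : Represents μ x) (hν : Represents ν y)
    {a b : ℝ} (ha : 0 ≤ a) (hb : 0 ≤ b) (hab : a + b = 1)
    (hz : (z : V) = a • (x : V) + b • (y : V)) :
    ∃ κ : ProbabilityMeasure (K.extremePoints ℝ), Represents κ z ∧
      ∀ f : K.extremePoints ℝ → ℝ, Continuous f →
        ∫ w, f w ∂(κ : Measure (K.extremePoints ℝ)) =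
          a * ∫ w, f w ∂(μ : Measure (K.extremePoints ℝ)) +
            b * ∫ w, f w ∂(ν : Measure (K.extremePoints ℝ)) := by
  have hprob : IsProbabilityMeasure (ENNReal.ofReal a • (μ : Measure (K.extremePoints ℝ)) +
      ENNReal.ofReal b • (ν : Measure (K.extremePoints ℝ))) := by
    constructor
    rw [Measure.add_apply, Measure.smul_apply, Measure.smul_apply, measure_univ, measure_univ,
      smul_eq_mul, smul_eq_mul, mul_one, mul_one, ← ENNReal.ofReal_add ha hb, hab,
      ENNReal.ofReal_one]
  have hint : ∀ f : K.extremePoints ℝ → ℝ, Continuous f →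
      ∫ w, f w ∂(ENNReal.ofReal a • (μ : Measure (K.extremePoints ℝ)) +
        ENNReal.ofReal b • (ν : Measure (K.extremePoints ℝ))) =
          a * ∫ w, f w ∂(μ : Measure (K.extremePoints ℝ)) +
            b * ∫ w, f w ∂(ν : Measure (K.extremePoints ℝ)) := by
    intro f hf
    rw [integral_add_measure
      ((integrable_of_compactSpace hf _).smul_measure ENNReal.ofReal_ne_top)
      ((integrable_of_compactSpace hf _).smul_measure ENNReal.ofReal_ne_top),
      integral_smul_measure, integral_smul_measure, ENNReal.toReal_ofReal ha,
      ENNReal.toReal_ofReal hb, smul_eq_mul, smul_eq_mul]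
  refine ⟨⟨_, hprob⟩, fun f hf => ?_, hint⟩
  rw [hf.affine x y z a b ha hb hab hz, hμ f hf, hν f hf]
  exact (hint _ (hf.continuous.comp continuous_boundaryIncl)).symm

end Represents

/-! ### Lipschitz extension -/

section Extension

variable {E : Type*} [NormedAddCommGroup E] [NormedSpace ℝ E] [PartialOrder E]
  {e : E} {L : E → ℝ≥0∞}

/-- On a quantum metric Bauer simplex the extension of `f` is `σ ↦ ∫ f dμ_σ`; that `σ ↦ μ_σ` is
isometric for the Wasserstein metric makes it Lipschitz, in particular continuous. -/
theorem IsQMBS.lipschitzExtension (hQ : IsQMBS e L) : LipschitzExtension e L := by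
  intro f hf
  have hL := hQ.lipNorm
  have hdense := hQ.denselyFinite
  have hcomp : CompactSpace ((stateSpace e).extremePoints ℝ) :=
    isCompact_iff_compactSpace.1 hQ.bauer.isCompact_boundary
  have hfc := hL.continuous_of_lipSeminorm_lt_top hdense hf
  have hfl := (hL.lipSeminorm_boundaryDist_le_iff hdense f _).1 le_rfl
  have hex : ∀ σ : stateSpace e, ∃ μ : ProbabilityMeasure ((stateSpace e).extremePoints ℝ),
      IsRepresentingMeasure μ σ := fun σ =>
    let ⟨μ, _, hμ, _⟩ := hQ.isometry σ σ
    ⟨μ, hμ⟩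
  choose μ hμ using hex
  set g : stateSpace e → ℝ := fun σ =>
    ∫ ω, f ω ∂(μ σ : Measure ((stateSpace e).extremePoints ℝ)) with hg
  have hlip : ∀ σ τ, ‖g σ - g τ‖ₑ ≤ lipSeminorm (boundaryDist e L) f * stateDist e L σ τ := by
    intro σ τ
    obtain ⟨κ, ν, hκ, hν, hdist⟩ := hQ.isometry σ τ
    rw [(hμ σ).2 κ hκ.1, (hμ τ).2 ν hν.1] at hdist
    rw [hdist]
    exact enorm_integral_sub_le_wasserstein (μ σ) (μ τ) hf.ne hfl
  have hbdry : ∀ ω, g (boundaryIncl ω) = f ω := fun ω => by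
    rw [hg]
    simp only
    rw [← (hμ (boundaryIncl ω)).2 _ (represents_dirac ω)]
    exact integral_dirac' _ _ hfc.stronglyMeasurable
  refine ⟨g, ⟨hL.continuous_of_enorm_sub_le continuous_id hf.ne hlip, ?_⟩, hbdry, ?_,
    (hL.lipSeminorm_stateDist_le_iff hdense g _).2 hlip, fun h hh hhf => ?_⟩
  · intro σ τ ω a b ha hb hab hω
    obtain ⟨κ, hκ, hint⟩ := (hμ σ).1.exists_convexCombination (hμ τ).1 ha hb hab hω
    rw [hg]
    simp only
    rw [← (hμ ω).2 κ hκ]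
    exact hint f hfc
  · refine iSup_le fun σ => ?_
    calc ‖g σ‖ₑ ≤ ∫⁻ ω, ‖f ω‖ₑ ∂(μ σ : Measure ((stateSpace e).extremePoints ℝ)) :=
          enorm_integral_le_lintegral_enorm _
      _ ≤ ∫⁻ _, uniformNorm f ∂(μ σ : Measure ((stateSpace e).extremePoints ℝ)) :=
          lintegral_mono fun ω => le_iSup (fun x => ‖f x‖ₑ) ω
      _ = uniformNorm f := by rw [lintegral_const, measure_univ, mul_one]
  · funext σ
    rw [(hμ σ).1 h hh]
    simp only [hhf]
    rfl

/-- The two suprema agree: elements with `L ≤ 1` restrict to admissible functions in the Wasserstein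
distance, and an admissible function extends to an element whose slope is still at most one. -/
theorem LipschitzExtension.isometry (hext : LipschitzExtension e L)
    (hL : IsLipNorm e L) (hdense : DenselyFinite L) {σ τ : stateSpace e}
    {μ ν : ProbabilityMeasure ((stateSpace e).extremePoints ℝ)} (hμ : Represents μ σ)
    (hν : Represents ν τ) : stateDist e L σ τ = wasserstein (boundaryDist e L) μ ν := by
  refine le_antisymm (iSup₂_le fun x hx => ?_) (iSup₂_le fun f hf => ?_)
  · have h1 := hμ _ (isContAffine_eval x)
    have h2 := hν _ (isContAffine_eval x)
    rw [h1, h2]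
    refine le_iSup₂ (f := fun (f : (stateSpace e).extremePoints ℝ → ℝ)
      (_ : ∀ x y, ‖f x - f y‖ₑ ≤ boundaryDist e L x y) =>
        ‖(∫ x, f x ∂(μ : Measure ((stateSpace e).extremePoints ℝ))) -
          ∫ x, f x ∂(ν : Measure ((stateSpace e).extremePoints ℝ))‖ₑ) _ fun ω ω' => ?_
    exact le_iSup₂ (f := fun x (_ : L x ≤ 1) => ‖(ω : WeakDual ℝ E) x - (ω' : WeakDual ℝ E) x‖ₑ)
      x hx
  · have hf1 : lipSeminorm (boundaryDist e L) f ≤ 1 :=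
      (hL.lipSeminorm_boundaryDist_le_iff hdense f 1).2 fun ω ω' => by
        rw [one_mul]
        exact hf ω ω'
    obtain ⟨g, hg, hgf, _, hlip, _⟩ := hext f (hf1.trans_lt ENNReal.one_lt_top)
    have h1 := (hL.lipSeminorm_stateDist_le_iff hdense g 1).1 (hlip.trans hf1) σ τ
    rw [one_mul, hμ g hg, hν g hg] at h1
    simpa only [hgf] using h1

variable [IsOrderedAddMonoid E] [IsOrderedModule ℝ E]

/-- On a quantum metric Bauer simplex `L` is recovered from the pure states: `x̂` is the unique
continuous affine extension of its restriction to the boundary, so it is no steeper there. -/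
theorem IsQMBS.eq_lipSeminorm (hQ : IsQMBS e L) (x : E) :
    L x = lipSeminorm (boundaryDist e L) (fun σ => (σ : WeakDual ℝ E) x) := by
  refine le_antisymm ?_ (hQ.lipNorm.lipSeminorm_eval_boundary_le hQ.denselyFinite x)
  rcases eq_top_or_lt_top (lipSeminorm (boundaryDist e L)
    (fun σ => (σ : WeakDual ℝ E) x)) with h | h
  · rw [h]
    exact le_top
  · obtain ⟨g, _, _, _, hlip, huniq⟩ := hQ.lipschitzExtension _ h
    rw [← huniq _ (isContAffine_eval x) fun _ => rfl] at hlip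
    exact (hQ.lipNorm.le_lipSeminorm_eval hQ.orderUnitSpace hQ.denselyFinite
      hQ.lowerSemicontinuous x).trans hlip

variable [CompleteSpace E]

namespace LipschitzExtension

theorem exists_max_of_lt_top (hext : LipschitzExtension e L) (he : IsOrderUnitSpace e)
    (hL : IsLipNorm e L) (hdense : DenselyFinite L) {x y : E} (hx : L x < ⊤) (hy : L y < ⊤) :
    ∃ z : E, ∀ ω ∈ (stateSpace e).extremePoints ℝ, ω z = max (ω x) (ω y) := by
  have hlip : lipSeminorm (boundaryDist e L)
      (fun ω => max ((ω : WeakDual ℝ E) x) ((ω : WeakDual ℝ E) y)) ≤ L x + L y := by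
    refine (hL.lipSeminorm_boundaryDist_le_iff hdense _ _).2 fun σ τ => ?_
    have hσ := extremePoints_subset σ.2
    have hτ := extremePoints_subset τ.2
    have h1 : |max ((σ : WeakDual ℝ E) x) ((σ : WeakDual ℝ E) y) -
        max ((τ : WeakDual ℝ E) x) ((τ : WeakDual ℝ E) y)| ≤
        |(σ : WeakDual ℝ E) x - (τ : WeakDual ℝ E) x| +
          |(σ : WeakDual ℝ E) y - (τ : WeakDual ℝ E) y| :=
      (abs_max_sub_max_le_max _ _ _ _).trans
        (max_le_add_of_nonneg (abs_nonneg _) (abs_nonneg _))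
    rw [Real.enorm_eq_ofReal_abs, add_mul]
    refine (ENNReal.ofReal_le_ofReal h1).trans ?_
    rw [ENNReal.ofReal_add (abs_nonneg _) (abs_nonneg _), ← Real.enorm_eq_ofReal_abs,
      ← Real.enorm_eq_ofReal_abs]
    exact add_le_add (hL.enorm_sub_le hσ hτ hx) (hL.enorm_sub_le hσ hτ hy)
  obtain ⟨g, hg, hgf, _⟩ := hext _ (hlip.trans_lt (ENNReal.add_lt_top.2 ⟨hx, hy⟩))
  obtain ⟨z, hz⟩ := he.exists_eval_eq hg
  exact ⟨z, fun ω hω => by rw [← hgf ⟨ω, hω⟩, hz]; rfl⟩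

/-- The pointwise maximum of two elements on the pure states is again an element. -/
theorem exists_max (hext : LipschitzExtension e L) (he : IsOrderUnitSpace e)
    (hL : IsLipNorm e L) (hdense : DenselyFinite L) (x y : E) :
    ∃ z : E, ∀ ω ∈ (stateSpace e).extremePoints ℝ, ω z = max (ω x) (ω y) := by
  obtain ⟨u, hu, hux⟩ := mem_closure_iff_seq_limit.1 (hdense x)
  obtain ⟨v, hv, hvy⟩ := mem_closure_iff_seq_limit.1 (hdense y)
  choose w hw using fun n => hext.exists_max_of_lt_top he hL hdense (hu n) (hv n)
  have hdist : ∀ n m, dist (w n) (w m) ≤ dist (u n, v n) (u m, v m) := by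
    intro n m
    rw [Prod.dist_eq, dist_eq_norm, dist_eq_norm, dist_eq_norm]
    refine he.norm_le_of_extremePoints (le_max_of_le_left (norm_nonneg _)) fun ω hω => ?_
    rw [map_sub, hw n ω hω, hw m ω hω]
    refine (abs_max_sub_max_le_max _ _ _ _).trans (max_le_max ?_ ?_)
    · rw [← map_sub]
      exact he.abs_state_le_norm (extremePoints_subset hω) _
    · rw [← map_sub]
      exact he.abs_state_le_norm (extremePoints_subset hω) _
  have hcauchy : CauchySeq w := by
    rw [Metric.cauchySeq_iff]
    intro ε hε
    obtain ⟨N, hN⟩ := Metric.cauchySeq_iff.1 (hux.prodMk_nhds hvy).cauchySeq ε hε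
    exact ⟨N, fun n hn m hm => (hdist n m).trans_lt (hN n hn m hm)⟩
  obtain ⟨z, hz⟩ := cauchySeq_tendsto_of_complete hcauchy
  refine ⟨z, fun ω hω => ?_⟩
  have hω : Continuous ω := (WeakDual.toStrongDual ω).continuous
  refine tendsto_nhds_unique ((hω.tendsto z).comp hz) ?_
  refine (((hω.tendsto x).comp hux).max ((hω.tendsto y).comp hvy)).congr fun n => ?_
  exact (hw n ω ‹_›).symm

theorem isVectorLattice (hext : LipschitzExtension e L) (he : IsOrderUnitSpace e)
    (hL : IsLipNorm e L) (hdense : DenselyFinite L) : IsVectorLattice E := by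
  have hsup : ∀ x y : E, ∃ z, IsLUB {x, y} z := by
    intro x y
    obtain ⟨z, hz⟩ := hext.exists_max he hL hdense x y
    refine ⟨z, ?_, fun u hu => he.le_of_extremePoints fun ω hω => ?_⟩
    · rintro _ (rfl | rfl)
      · exact he.le_of_extremePoints fun ω hω => (hz ω hω).symm ▸ le_max_left _ _
      · exact he.le_of_extremePoints fun ω hω => (hz ω hω).symm ▸ le_max_right _ _
    · rw [hz ω hω]
      exact max_le (state_mono (extremePoints_subset hω) (hu (by simp)))
        (state_mono (extremePoints_subset hω) (hu (by simp)))
  refine fun x y => ⟨hsup x y, ?_⟩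
  obtain ⟨z, hz⟩ := hsup (-x) (-y)
  refine ⟨-z, ?_, fun u hu => ?_⟩
  · rintro _ (rfl | rfl)
    · exact neg_le.1 (hz.1 (by simp))
    · exact neg_le.1 (hz.1 (by simp))
  · refine le_neg.1 (hz.2 ?_)
    rintro _ (rfl | rfl)
    · exact neg_le_neg (hu (by simp))
    · exact neg_le_neg (hu (by simp))

end LipschitzExtension

end Extension

section Bauer

variable {E : Type*} [NormedAddCommGroup E] [NormedSpace ℝ E] [PartialOrder E]
  [IsOrderedAddMonoid E] {e : E} {L : E → ℝ≥0∞}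

/-! ### Compactness of the extreme boundary -/

/-- A state that turns some upper bound of `x` and `y` into the maximum, for all `x` and `y`, is
pure: if `τ` occurs in a convex decomposition of `σ` and `σ(x) = 0`, then `τ` vanishes on a bound
`z ≥ ±x` with `σ(z) = 0`, hence on `x`. -/
theorem mem_extremePoints_of_max {σ : WeakDual ℝ E} (hσ : σ ∈ stateSpace e)
    (h : ∀ x y : E, ∃ z, x ≤ z ∧ y ≤ z ∧ σ z = max (σ x) (σ y)) :
    σ ∈ (stateSpace e).extremePoints ℝ := by
  refine ⟨hσ, fun τ hτ ω hω hseg => ?_⟩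
  obtain ⟨a, b, ha, hb, -, hab⟩ := hseg
  refine DFunLike.ext _ _ fun x => ?_
  have hx₀ : σ (x - σ x • e) = 0 := by
    rw [map_sub, map_smul, hσ.2, smul_eq_mul, mul_one, sub_self]
  obtain ⟨z, h1, h2, h3⟩ := h (x - σ x • e) (-(x - σ x • e))
  rw [map_neg, hx₀, neg_zero, max_self] at h3
  have hsum : a * τ z + b * ω z = 0 := by
    rw [← h3, ← hab]
    rfl
  have hbound : ∀ φ ∈ stateSpace e, |φ (x - σ x • e)| ≤ φ z := fun φ hφ => by
    have h4 := state_mono hφ h2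
    rw [map_neg] at h4
    exact abs_le.2 ⟨by linarith, state_mono hφ h1⟩
  have hτz : τ z ≤ 0 := by
    have h4 := mul_nonneg hb.le ((abs_nonneg _).trans (hbound ω hω))
    by_contra! h5
    linarith [mul_pos ha h5]
  have h6 := abs_nonpos_iff.1 ((hbound τ hτ).trans hτz)
  rw [map_sub, map_smul, hτ.2, smul_eq_mul, mul_one, sub_eq_zero] at h6
  exact h6

variable [IsOrderedModule ℝ E]

theorem LipschitzExtension.isCompact_extremePoints [CompleteSpace E] (hext : LipschitzExtension e L)
    (he : IsOrderUnitSpace e) (hL : IsLipNorm e L) (hdense : DenselyFinite L) :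
    IsCompact ((stateSpace e).extremePoints ℝ) := by
  refine he.isCompact_stateSpace.of_isClosed_subset (isClosed_of_closure_subset fun σ hσ => ?_)
    extremePoints_subset
  refine mem_extremePoints_of_max
    (closure_minimal extremePoints_subset isClosed_stateSpace hσ) fun x y => ?_
  obtain ⟨z, hz⟩ := hext.exists_max he hL hdense x y
  have hclosed : IsClosed {φ : WeakDual ℝ E | φ z = max (φ x) (φ y)} :=
    isClosed_eq (WeakDual.eval_continuous z)
      ((WeakDual.eval_continuous x).max (WeakDual.eval_continuous y))
  exact ⟨z, he.le_of_extremePoints fun ω hω => (hz ω hω).symm ▸ le_max_left _ _,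
    he.le_of_extremePoints fun ω hω => (hz ω hω).symm ▸ le_max_right _ _,
    closure_minimal hz hclosed hσ⟩

/-! ### The cone over the state space -/

theorem mem_assocCone_iff (he : IsOrderUnitSpace e) (hne : (stateSpace e).Nonempty)
    (p : WeakDual ℝ E × ℝ) :
    p ∈ assocCone (stateSpace e) ↔ (∀ x, 0 ≤ x → 0 ≤ p.1 x) ∧ p.2 = p.1 e := by
  constructor
  · rintro ⟨t, ht, σ, hσ, rfl⟩
    refine ⟨fun x hx => mul_nonneg ht (hσ.1 x hx), ?_⟩
    change t = t * σ e
    rw [hσ.2, mul_one]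
  · rintro ⟨hpos, h2⟩
    have ht := hpos e he.unit_nonneg
    refine ⟨p.1 e, ht, ?_⟩
    rcases ht.eq_or_lt with h0 | h0
    · obtain ⟨σ, hσ⟩ := hne
      refine ⟨σ, hσ, Prod.ext (DFunLike.ext _ _ fun x => ?_) h2⟩
      have hmono : ∀ y z : E, y ≤ z → p.1 y ≤ p.1 z := fun y z h => by
        have := hpos _ (sub_nonneg.2 h)
        rw [map_sub] at this
        linarith
      have h3 := hmono _ _ (he.le_norm_smul x)
      have h4 := hmono _ _ (he.neg_norm_smul_le x)
      rw [map_neg] at h4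
      rw [map_smul, ← h0, smul_zero] at h3 h4
      change p.1 x = p.1 e * σ x
      rw [← h0, zero_mul]
      linarith
    · refine ⟨(p.1 e)⁻¹ • p.1, ⟨fun x hx => mul_nonneg (inv_nonneg.2 ht) (hpos x hx),
        inv_mul_cancel₀ h0.ne'⟩, Prod.ext ?_ h2⟩
      rw [smul_smul, mul_inv_cancel₀ h0.ne', one_smul]

/-! ### Functions and measures on the extreme boundary -/

section Boundary

variable [CompactSpace ((stateSpace e).extremePoints ℝ)]

/-- The isometric embedding of `E` into the continuous functions on the extreme boundary. -/
noncomputable def boundaryRestrict (he : IsOrderUnitSpace e) :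
    E →ₗᵢ[ℝ] C((stateSpace e).extremePoints ℝ, ℝ) where
  toFun x := ⟨fun ω => (ω : WeakDual ℝ E) x,
    (WeakDual.eval_continuous x).comp continuous_subtype_val⟩
  map_add' x y := by
    ext ω
    exact map_add (ω : WeakDual ℝ E) x y
  map_smul' r x := by
    ext ω
    exact map_smul (ω : WeakDual ℝ E) r x
  norm_map' x := by
    refine le_antisymm ((ContinuousMap.norm_le _ (norm_nonneg x)).2 fun ω =>
      he.abs_state_le_norm (extremePoints_subset ω.2) x) ?_
    exact he.norm_le_of_extremePoints (norm_nonneg _) fun ω hω =>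
      ContinuousMap.norm_coe_le_norm (⟨fun ω => (ω : WeakDual ℝ E) x,
        (WeakDual.eval_continuous x).comp continuous_subtype_val⟩ :
          C((stateSpace e).extremePoints ℝ, ℝ)) ⟨ω, hω⟩

/-- By the lattice form of the Stone–Weierstrass theorem, `E` is all of `C(∂S(E))`. -/
theorem boundaryRestrict_surjective [CompleteSpace E] (he : IsOrderUnitSpace e)
    (hmax : ∀ x y : E, ∃ z, ∀ ω ∈ (stateSpace e).extremePoints ℝ, ω z = max (ω x) (ω y)) :
    Function.Surjective (boundaryRestrict he) := by
  have hclosed : IsClosed (Set.range (boundaryRestrict he)) :=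
    (boundaryRestrict he).isometry.isClosedEmbedding.isClosed_range
  have hsup : ∀ f ∈ Set.range (boundaryRestrict he), ∀ g ∈ Set.range (boundaryRestrict he),
      f ⊔ g ∈ Set.range (boundaryRestrict he) := by
    rintro _ ⟨x, rfl⟩ _ ⟨y, rfl⟩
    obtain ⟨z, hz⟩ := hmax x y
    refine ⟨z, ?_⟩
    ext ω
    exact hz ω ω.2
  have hneg : ∀ f ∈ Set.range (boundaryRestrict he), -f ∈ Set.range (boundaryRestrict he) := by
    rintro _ ⟨x, rfl⟩
    exact ⟨-x, map_neg _ x⟩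
  have htop := ContinuousMap.sublattice_closure_eq_top (Set.range (boundaryRestrict he))
    ⟨_, 0, rfl⟩ (fun f hf g hg => ?_) hsup ?_
  · rw [hclosed.closure_eq] at htop
    exact Set.range_eq_univ.1 htop
  · have h := hneg _ (hsup _ (hneg f hf) _ (hneg g hg))
    have hfg : f ⊓ g = -(-f ⊔ -g) := by
      ext ω
      simp [max_neg_neg]
    rwa [hfg]
  · intro v ω τ
    by_cases hωτ : ω = τ
    · subst hωτ
      refine ⟨_, ⟨v ω • e, rfl⟩, ?_⟩
      have h1 : (ω : WeakDual ℝ E) (v ω • e) = v ω := by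
        rw [map_smul, (extremePoints_subset ω.2).2, smul_eq_mul, mul_one]
      exact ⟨h1, h1⟩
    · obtain ⟨x, hx⟩ : ∃ x, (ω : WeakDual ℝ E) x ≠ (τ : WeakDual ℝ E) x := by
        by_contra! h
        exact hωτ (Subtype.ext (DFunLike.ext _ _ h))
      -- the line through the two prescribed values
      set α := (v ω - v τ) / ((ω : WeakDual ℝ E) x - (τ : WeakDual ℝ E) x) with hα
      have hval : ∀ σ : (stateSpace e).extremePoints ℝ,
          boundaryRestrict he (α • x + (v ω - α * (ω : WeakDual ℝ E) x) • e) σ =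
            α * (σ : WeakDual ℝ E) x + (v ω - α * (ω : WeakDual ℝ E) x) := fun σ => by
        change (σ : WeakDual ℝ E) _ = _
        rw [map_add, map_smul, map_smul, (extremePoints_subset σ.2).2, smul_eq_mul, smul_eq_mul,
          mul_one]
      refine ⟨_, Set.mem_range_self (α • x + (v ω - α * (ω : WeakDual ℝ E) x) • e), ?_, ?_⟩
      · rw [hval]
        ring
      · rw [hval, hα]
        have := sub_ne_zero.2 hx
        field_simp
        ring

/-- The positive functional `x ↦ ∫ x̂ dκ` of a measure `κ` on the extreme boundary. -/
noncomputable def measureFunctional (he : IsOrderUnitSpace e)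
    (κ : Measure ((stateSpace e).extremePoints ℝ)) [IsFiniteMeasure κ] : WeakDual ℝ E :=
  StrongDual.toWeakDual (LinearMap.mkContinuous
    { toFun := fun x => ∫ ω, boundaryRestrict he x ω ∂κ
      map_add' := fun x y => by
        rw [map_add]
        exact integral_add (integrable_of_compactSpace (map_continuous _) κ)
          (integrable_of_compactSpace (map_continuous _) κ)
      map_smul' := fun r x => by
        rw [map_smul]
        exact integral_const_mul r _ }
    (κ.real Set.univ) fun x => by
      rw [mul_comm, ← (boundaryRestrict he).norm_map x]
      exact norm_integral_le_of_norm_le_const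
        (Filter.Eventually.of_forall fun ω => ContinuousMap.norm_coe_le_norm _ ω))

theorem measureFunctional_apply (he : IsOrderUnitSpace e)
    (κ : Measure ((stateSpace e).extremePoints ℝ)) [IsFiniteMeasure κ] (x : E) :
    measureFunctional he κ x = ∫ ω : (stateSpace e).extremePoints ℝ, (ω : WeakDual ℝ E) x ∂κ :=
  rfl

theorem measureFunctional_unit (he : IsOrderUnitSpace e)
    (κ : Measure ((stateSpace e).extremePoints ℝ)) [IsFiniteMeasure κ] :
    measureFunctional he κ e = κ.real Set.univ := by
  have h : ∀ ω : (stateSpace e).extremePoints ℝ, (ω : WeakDual ℝ E) e = 1 := fun ω =>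
    (extremePoints_subset ω.2).2
  rw [measureFunctional_apply]
  simp [h]

theorem measureFunctional_nonneg (he : IsOrderUnitSpace e)
    (κ : Measure ((stateSpace e).extremePoints ℝ)) [IsFiniteMeasure κ] {x : E} (hx : 0 ≤ x) :
    0 ≤ measureFunctional he κ x := by
  rw [measureFunctional_apply]
  exact integral_nonneg fun ω => (extremePoints_subset ω.2).1 x hx

theorem measureFunctional_add (he : IsOrderUnitSpace e)
    (κ μ : Measure ((stateSpace e).extremePoints ℝ)) [IsFiniteMeasure κ] [IsFiniteMeasure μ] :
    measureFunctional he (κ + μ) = measureFunctional he κ + measureFunctional he μ := by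
  refine DFunLike.ext _ _ fun x => ?_
  exact integral_add_measure
    (integrable_of_compactSpace (map_continuous (boundaryRestrict he x)) κ)
    (integrable_of_compactSpace (map_continuous (boundaryRestrict he x)) μ)

/-- The Riesz–Markov–Kakutani theorem on the extreme boundary. -/
theorem exists_measureFunctional_eq (he : IsOrderUnitSpace e)
    (hsurj : Function.Surjective (boundaryRestrict he)) (φ : WeakDual ℝ E)
    (hφ : ∀ x, 0 ≤ x → 0 ≤ φ x) :
    ∃ (κ : Measure ((stateSpace e).extremePoints ℝ)) (_ : IsFiniteMeasure κ),
      φ = measureFunctional he κ := by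
  let Φ := LinearIsometryEquiv.ofSurjective (boundaryRestrict he) hsurj
  have hΦ : ∀ (f : C((stateSpace e).extremePoints ℝ, ℝ)) (ω : (stateSpace e).extremePoints ℝ),
      (ω : WeakDual ℝ E) (Φ.symm f) = f ω := fun f ω => by
    have := congrArg (fun g : C((stateSpace e).extremePoints ℝ, ℝ) => g ω) (Φ.apply_symm_apply f)
    exact this
  let Λ : CompactlySupportedContinuousMap ((stateSpace e).extremePoints ℝ) ℝ →ₚ[ℝ] ℝ :=
    PositiveLinearMap.mk₀
      { toFun := fun f => φ (Φ.symm f.toContinuousMap)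
        map_add' := fun f g => by
          rw [← map_add, ← map_add]
          rfl
        map_smul' := fun r f => by
          rw [← map_smul, ← map_smul]
          rfl }
      (fun f hf => hφ _ (he.le_of_extremePoints fun ω hω => by
        rw [map_zero]
        exact (hf ⟨ω, hω⟩).trans_eq (hΦ f.toContinuousMap ⟨ω, hω⟩).symm))
  refine ⟨RealRMK.rieszMeasure Λ, inferInstance, DFunLike.ext _ _ fun x => ?_⟩
  have h := RealRMK.integral_rieszMeasure Λ
    (CompactlySupportedContinuousMap.continuousMapEquiv (boundaryRestrict he x))
  have h2 : Λ (CompactlySupportedContinuousMap.continuousMapEquiv (boundaryRestrict he x)) =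
      φ (Φ.symm (Φ x)) := rfl
  rw [h2, Φ.symm_apply_apply] at h
  exact h.symm

/-! ### The lattice cone -/

/-- The point of the cone over the state space defined by a measure on the extreme boundary: its
functional, at the height given by the value at the unit, which is the total mass. -/
noncomputable def conePoint (he : IsOrderUnitSpace e) (κ : Measure ((stateSpace e).extremePoints ℝ))
    [IsFiniteMeasure κ] : WeakDual ℝ E × ℝ :=
  (measureFunctional he κ, measureFunctional he κ e)

theorem conePoint_mem (he : IsOrderUnitSpace e) (hne : (stateSpace e).Nonempty)
    (κ : Measure ((stateSpace e).extremePoints ℝ)) [IsFiniteMeasure κ] :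
    conePoint he κ ∈ assocCone (stateSpace e) :=
  (mem_assocCone_iff he hne _).2 ⟨fun _ hx => measureFunctional_nonneg he κ hx, rfl⟩

theorem exists_conePoint_eq (he : IsOrderUnitSpace e) (hne : (stateSpace e).Nonempty)
    (hsurj : Function.Surjective (boundaryRestrict he)) {p : WeakDual ℝ E × ℝ}
    (hp : p ∈ assocCone (stateSpace e)) :
    ∃ (κ : Measure ((stateSpace e).extremePoints ℝ)) (_ : IsFiniteMeasure κ),
      p = conePoint he κ := by
  obtain ⟨h1, h2⟩ := (mem_assocCone_iff he hne p).1 hp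
  obtain ⟨κ, hκ, h⟩ := exists_measureFunctional_eq he hsurj p.1 h1
  exact ⟨κ, hκ, Prod.ext h (by rw [h2, h]; rfl)⟩

theorem conePoint_add (he : IsOrderUnitSpace e)
    (κ μ : Measure ((stateSpace e).extremePoints ℝ)) [IsFiniteMeasure κ] [IsFiniteMeasure μ] :
    conePoint he (κ + μ) = conePoint he κ + conePoint he μ := by
  unfold conePoint
  rw [measureFunctional_add]
  rfl

variable [TopologicalSpace.SeparableSpace E]

/-- Separability of `E` makes the boundary metrizable, so a finite Borel measure on it is determined
by the integrals of continuous functions. -/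
theorem measureFunctional_injective (he : IsOrderUnitSpace e)
    (hsurj : Function.Surjective (boundaryRestrict he))
    {κ μ : Measure ((stateSpace e).extremePoints ℝ)} [IsFiniteMeasure κ] [IsFiniteMeasure μ]
    (h : measureFunctional he κ = measureFunctional he μ) : κ = μ := by
  have : TopologicalSpace.MetrizableSpace ((stateSpace e).extremePoints ℝ) :=
    WeakDual.metrizable_of_isCompact ℝ E _ (isCompact_iff_compactSpace.2 inferInstance)
  refine ext_of_forall_integral_eq_of_IsFiniteMeasure fun f => ?_
  obtain ⟨x, hx⟩ := hsurj f.toContinuousMap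
  have hf : ∀ ω, f ω = boundaryRestrict he x ω := fun ω => by
    rw [hx]
    rfl
  simp only [hf]
  exact DFunLike.congr_fun h x

/-- The order of the cone is the order of measures. -/
theorem conePoint_sub_mem_iff (he : IsOrderUnitSpace e) (hne : (stateSpace e).Nonempty)
    (hsurj : Function.Surjective (boundaryRestrict he))
    (κ μ : Measure ((stateSpace e).extremePoints ℝ)) [IsFiniteMeasure κ] [IsFiniteMeasure μ] :
    conePoint he μ - conePoint he κ ∈ assocCone (stateSpace e) ↔ κ ≤ μ := by
  constructor
  · intro h
    obtain ⟨ν, hν, hsub⟩ := exists_conePoint_eq he hne hsurj h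
    rw [sub_eq_iff_eq_add, ← conePoint_add] at hsub
    rw [measureFunctional_injective he hsurj (congrArg Prod.fst hsub :
      measureFunctional he μ = measureFunctional he (ν + κ))]
    exact Measure.le_add_left le_rfl
  · intro h
    have hadd : conePoint he μ = conePoint he (μ - κ) + conePoint he κ := by
      rw [← conePoint_add]
      congr 1
      exact (Measure.sub_add_cancel_of_le h).symm
    rw [hadd, add_sub_cancel_right]
    exact conePoint_mem he hne _

/-- The cone over the state space is the cone of finite measures on the extreme boundary, a
lattice. -/
theorem isLatticeCone_assocCone (he : IsOrderUnitSpace e)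
    (hsurj : Function.Surjective (boundaryRestrict he)) :
    IsLatticeCone (assocCone (stateSpace e)) := by
  intro p hp q hq
  have hne : (stateSpace e).Nonempty := by
    obtain ⟨_, _, σ, hσ, _⟩ := hp
    exact ⟨σ, hσ⟩
  obtain ⟨κ, hκ, rfl⟩ := exists_conePoint_eq he hne hsurj hp
  obtain ⟨μ, hμ, rfl⟩ := exists_conePoint_eq he hne hsurj hq
  have hsup : IsFiniteMeasure (κ ⊔ μ) :=
    isFiniteMeasure_of_le (κ + μ)
      (sup_le (Measure.le_add_right le_rfl) (Measure.le_add_left le_rfl))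
  have hinf : IsFiniteMeasure (κ ⊓ μ) := isFiniteMeasure_of_le κ inf_le_left
  refine ⟨⟨conePoint he (κ ⊔ μ), conePoint_mem he hne _,
    (conePoint_sub_mem_iff he hne hsurj _ _).2 le_sup_left,
    (conePoint_sub_mem_iff he hne hsurj _ _).2 le_sup_right, fun u hu h1 h2 => ?_⟩,
    ⟨conePoint he (κ ⊓ μ), conePoint_mem he hne _,
    (conePoint_sub_mem_iff he hne hsurj _ _).2 inf_le_left,
    (conePoint_sub_mem_iff he hne hsurj _ _).2 inf_le_right, fun u hu h1 h2 => ?_⟩⟩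
  · obtain ⟨ν, hν, rfl⟩ := exists_conePoint_eq he hne hsurj hu
    rw [conePoint_sub_mem_iff he hne hsurj] at h1 h2 ⊢
    exact sup_le h1 h2
  · obtain ⟨ν, hν, rfl⟩ := exists_conePoint_eq he hne hsurj hu
    rw [conePoint_sub_mem_iff he hne hsurj] at h1 h2 ⊢
    exact le_inf h1 h2

theorem exists_isRepresentingMeasure [CompleteSpace E] (he : IsOrderUnitSpace e)
    (hsurj : Function.Surjective (boundaryRestrict he)) (σ : stateSpace e) :
    ∃ μ : ProbabilityMeasure ((stateSpace e).extremePoints ℝ), IsRepresentingMeasure μ σ := by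
  obtain ⟨κ, hκ, hσκ⟩ := exists_measureFunctional_eq he hsurj σ σ.2.1
  have hprob : IsProbabilityMeasure κ := by
    rw [isProbabilityMeasure_iff_real, ← measureFunctional_unit he κ, ← hσκ, σ.2.2]
  refine ⟨⟨κ, hprob⟩, fun f hf => ?_, fun ν hν => ?_⟩
  · obtain ⟨x, hx⟩ := he.exists_eval_eq hf
    simp only [hx]
    exact DFunLike.congr_fun hσκ x
  · refine Subtype.ext (measureFunctional_injective he hsurj (κ := (ν : Measure _)) (μ := κ) ?_)
    rw [← hσκ]
    refine DFunLike.ext _ _ fun x => ?_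
    exact (hν _ (isContAffine_eval x)).symm

end Boundary

/-! ### From Lipschitz extension to the Bauer simplex -/

theorem LipschitzExtension.isQMBS [CompleteSpace E]
    [TopologicalSpace.SeparableSpace E] (hext : LipschitzExtension e L) (he : IsOrderUnitSpace e)
    (hL : IsLipNorm e L) (hdense : DenselyFinite L) (hlsc : LowerSemicontinuous L)
    (hlat : IsVectorLattice E) : IsQMBS e L := by
  have hcompact := hext.isCompact_extremePoints he hL hdense
  have : CompactSpace ((stateSpace e).extremePoints ℝ) := isCompact_iff_compactSpace.1 hcompact
  have hsurj := boundaryRestrict_surjective he (hext.exists_max he hL hdense)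
  refine
    { orderUnitSpace := he
      lipNorm := hL
      complete := inferInstance
      riesz := fun x₁ x₂ y₁ y₂ h11 h12 h21 h22 => ?_
      lowerSemicontinuous := hlsc
      denselyFinite := hdense
      bauer := ⟨⟨he.isCompact_stateSpace, convex_stateSpace,
        isLatticeCone_assocCone he hsurj⟩, hcompact⟩
      isometry := fun σ τ => ?_ }
  · obtain ⟨⟨z, hz⟩, _⟩ := hlat x₁ x₂
    refine ⟨z, hz.1 (by simp), hz.1 (by simp), hz.2 ?_, hz.2 ?_⟩
    · rintro _ (rfl | rfl)
      exacts [h11, h21]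
    · rintro _ (rfl | rfl)
      exacts [h12, h22]
  · obtain ⟨μ, hμ⟩ := exists_isRepresentingMeasure he hsurj σ
    obtain ⟨ν, hν⟩ := exists_isRepresentingMeasure he hsurj τ
    exact ⟨μ, ν, hμ, hν, hext.isometry hL hdense hμ.1 hν.1⟩

end Bauer

end QuantumMetric

theorem mainTheorem11 {E : Type*} [NormedAddCommGroup E] [NormedSpace ℝ E] [PartialOrder E]
    [IsOrderedAddMonoid E] [IsOrderedModule ℝ E] [CompleteSpace E]
    [TopologicalSpace.SeparableSpace E]
    (e : E) (he : QuantumMetric.IsOrderUnitSpace e)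
    (L : E → ℝ≥0∞) (hL : QuantumMetric.IsLipNorm e L)
    (hdense : QuantumMetric.DenselyFinite L) (hlsc : LowerSemicontinuous L) :
    (QuantumMetric.IsQMBS e L ↔
      QuantumMetric.IsVectorLattice E ∧ QuantumMetric.LipschitzExtension e L) ∧
    (QuantumMetric.IsQMBS e L → ∀ x : E,
      L x = QuantumMetric.lipSeminorm (QuantumMetric.boundaryDist e L)
        (fun σ => (σ : WeakDual ℝ E) x)) := by
  refine ⟨⟨fun hQ => ⟨?_, hQ.lipschitzExtension⟩, fun ⟨hlat, hext⟩ => ?_⟩,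
    fun hQ => hQ.eq_lipSeminorm⟩
  · exact hQ.lipschitzExtension.isVectorLattice he hL hdense
  · exact hext.isQMBS he hL hdense hlsc hlat
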